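/- Let $K$ be any field and let $E$ be the graph $u\xrightarrow{\,e\,}v\xrightarrow{\,f\,}w$. For a directed graph $G$ (with arbitrarily many vertices and edges) and a field $F$, the Leavitt path algebra $L_F(G)$ is the (not necessarily unital) $F$-algebra generated by the vertices, the edges $g$ and the ghost edges $g^*$ of $G$ subject to $aa=a$ and $ab=0$ for vertices $a\neq b$; $\mathbf s(g)g=g\,\mathbf r(g)=g$ and $\mathbf r(g)g^*=g^*\mathbf s(g)=g^*$; $g^*g=\mathbf r(g)$ and $g^*h=0$ for edges $g\ne h$; and $a=\sum_{\mathbf s(g)=a}gg^*$ for every vertex $a$ that emits at least one and only finitely many edges. It is $\mathbb Z$-graded, with $L_F(G)_n$ the $F$-span of the elements $pq^*$ for paths $p,q$ with $|p|-|q|=n$. For integers $\gamma_1,\dots,\gamma_m$, let $\mathbb M_m(K)(\gamma_1,\dots,\gamma_m)$ be the matrix ring $\mathbb M_m(K)$ with the $\mathbb Z$-grading in which $(r_{ij})$ has degree $\delta$ iff $r_{ij}\in K_{-\gamma_i+\delta+\gamma_j}$ for all $i,j$, where $K_0=K$ and $K_n=0$ for $n\ne 0$. A graded isomorphism is a ring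 isomorphism mapping each component onto the component of the same degree. Then: 1. There is a graded $K$-algebra isomorphism $L_K(E)\cong_{\rm gr}\mathbb M_3(K)(0,1,2)$ which maps $u+w$ to $e_{11}+e_{33}$. 2. The element $u+w$ is an idempotent of degree $0$, and the graded corner $(u+w)L_K(E)(u+w)$ (with the grading induced from $L_K(E)$) is isomorphic to $\mathbb M_2(K)(0,2)$ as a graded $K$-algebra. 3. For every field $F$ and every directed graph $G$, neither $(u+w)L_K(E)(u+w)$ nor $\mathbb M_2(K)(0,2)$ is isomorphic to $L_F(G)$ as a graded ring. In particular, a graded corner of the Leavitt path algebra of a finite graph need not be graded isomorphic to a Leavitt path algebra. 4. In contrast, if the gradings are disregarded, the corner $(u+w)L_K(E)(u+w)$ is isomorphic as a $K$-algebra to the Leavitt path algebra $L_K(G)$ of some finite graph $G$. -/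

import Mathlib

/-! ### Leavitt path algebras

A directed graph is a quiver: the vertices are the elements of `V`, the edges from `a` to `b` are
the elements of `a ⟶ b` (arbitrary types, so multiple edges, loops and infinite graphs are allowed).
-/

universe u v w x

/-- The edges of a directed graph emitted by the vertex `a`. -/
abbrev EmittedEdges {V : Type v} [Quiver.{w} V] (a : V) : Type (max v w) :=
  Σ b : V, a ⟶ b

/-- The generators `E⁰ ∪ E¹ ∪ {e* | e ∈ E¹}` of a Leavitt path algebra. -/
inductive LeavittGen (V : Type v) [Quiver.{w} V] : Type (max v w)
  | vertex (a : V) : LeavittGen V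
  | edge {a b : V} (e : a ⟶ b) : LeavittGen V
  | ghost {a b : V} (e : a ⟶ b) : LeavittGen V

section Relations

variable (K : Type u) [Field K] (V : Type v) [Quiver.{w} V]

/-- The vertex `a` in the free algebra. -/
abbrev freeVertex {V : Type v} [Quiver.{w} V] (a : V) : FreeAlgebra K (LeavittGen V) :=
  FreeAlgebra.ι K (LeavittGen.vertex a)

/-- The edge `e` in the free algebra. -/
abbrev freeEdge {V : Type v} [Quiver.{w} V] {a b : V} (e : a ⟶ b) :
    FreeAlgebra K (LeavittGen V) :=
  FreeAlgebra.ι K (LeavittGen.edge e)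

/-- The ghost edge `e*` in the free algebra. -/
abbrev freeGhost {V : Type v} [Quiver.{w} V] {a b : V} (e : a ⟶ b) :
    FreeAlgebra K (LeavittGen V) :=
  FreeAlgebra.ι K (LeavittGen.ghost e)

/-- The defining relations of the Leavitt path algebra. In `ck1_ne` the two edges are arbitrary
distinct edges of the graph, with any sources and ranges (`Quiver.Total V` is the type of all
edges). In `ck2` the vertex `a` is regular: it emits at least one and only finitely many edges. -/
inductive LeavittRel : FreeAlgebra K (LeavittGen V) → FreeAlgebra K (LeavittGen V) → Prop
  | vertex_mul_self (a : V) : LeavittRel (freeVertex K a * freeVertex K a) (freeVertex K a)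
  | vertex_mul_of_ne {a b : V} (h : a ≠ b) : LeavittRel (freeVertex K a * freeVertex K b) 0
  | source_mul_edge {a b : V} (e : a ⟶ b) :
      LeavittRel (freeVertex K a * freeEdge K e) (freeEdge K e)
  | edge_mul_range {a b : V} (e : a ⟶ b) :
      LeavittRel (freeEdge K e * freeVertex K b) (freeEdge K e)
  | range_mul_ghost {a b : V} (e : a ⟶ b) :
      LeavittRel (freeVertex K b * freeGhost K e) (freeGhost K e)
  | ghost_mul_source {a b : V} (e : a ⟶ b) :
      LeavittRel (freeGhost K e * freeVertex K a) (freeGhost K e)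
  | ck1_self {a b : V} (e : a ⟶ b) : LeavittRel (freeGhost K e * freeEdge K e) (freeVertex K b)
  | ck1_ne {e f : Quiver.Total V} (h : e ≠ f) :
      LeavittRel (freeGhost K e.hom * freeEdge K f.hom) 0
  | ck2 (a : V) [Fintype (EmittedEdges a)] [Nonempty (EmittedEdges a)] :
      LeavittRel (freeVertex K a)
        (∑ e : EmittedEdges a, freeEdge K e.2 * freeGhost K e.2)

/-- The unital `K`-algebra generated by the vertices, edges and ghost edges subject to the
relations. Since no relation has a constant term, it is the unitization of the Leavitt path
algebra (the unit of this ring is an additional one, also when `V` is finite). -/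
abbrev LeavittUnitization : Type (max u v w) := RingQuot (LeavittRel K V)

/-- The class of a generator. -/
noncomputable def leavittGenClass (g : LeavittGen V) : LeavittUnitization K V :=
  RingQuot.mkAlgHom K (LeavittRel K V) (FreeAlgebra.ι K g)

/-- The Leavitt path algebra `L_K(E)` as a subalgebra of its unitization: the not necessarily
unital `K`-algebra generated by the vertices, edges and ghost edges subject to the relations. -/
def leavittSubalgebra : NonUnitalSubalgebra K (LeavittUnitization K V) :=
  NonUnitalAlgebra.adjoin K (Set.range (leavittGenClass K V))

/-- The Leavitt path algebra `L_K(E)` of the graph `E` with vertex type `V`: a `K`-algebra that has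
a unit only if `V` is finite (namely, the sum of all vertices). -/
def LeavittPathAlgebra : Type (max u v w) := leavittSubalgebra K V

noncomputable instance LeavittPathAlgebra.instNonUnitalRing :
    NonUnitalRing (LeavittPathAlgebra K V) :=
  inferInstanceAs (NonUnitalRing (leavittSubalgebra K V))

noncomputable instance LeavittPathAlgebra.instModule : Module K (LeavittPathAlgebra K V) :=
  inferInstanceAs (Module K (leavittSubalgebra K V))

instance LeavittPathAlgebra.instIsScalarTower :
    IsScalarTower K (LeavittPathAlgebra K V) (LeavittPathAlgebra K V) :=
  inferInstanceAs (IsScalarTower K (leavittSubalgebra K V) (leavittSubalgebra K V))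

instance LeavittPathAlgebra.instSMulCommClass :
    SMulCommClass K (LeavittPathAlgebra K V) (LeavittPathAlgebra K V) :=
  inferInstanceAs (SMulCommClass K (leavittSubalgebra K V) (leavittSubalgebra K V))

end Relations

namespace LeavittPathAlgebra

variable (K : Type u) [Field K] {V : Type v} [Quiver.{w} V]

/-- A generator as an element of `L_K(E)`. -/
noncomputable def gen (g : LeavittGen V) : LeavittPathAlgebra K V :=
  ⟨leavittGenClass K V g, NonUnitalAlgebra.subset_adjoin K (Set.mem_range_self g)⟩

/-- The vertex `a` as an element of `L_K(E)`. -/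
noncomputable def vertex (a : V) : LeavittPathAlgebra K V := gen K (LeavittGen.vertex a)

/-- The edge `e` as an element of `L_K(E)`. -/
noncomputable def edge {a b : V} (e : a ⟶ b) : LeavittPathAlgebra K V := gen K (LeavittGen.edge e)

/-- The ghost edge `e*` as an element of `L_K(E)`. -/
noncomputable def ghost {a b : V} (e : a ⟶ b) : LeavittPathAlgebra K V := gen K (LeavittGen.ghost e)

/-- The element of `L_K(E)` given by a path `p = e₁ ⋯ eₙ` (a vertex if `n = 0`). -/
noncomputable def path {a : V} : {b : V} → Quiver.Path a b → LeavittPathAlgebra K V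
  | _, Quiver.Path.nil => vertex K a
  | _, Quiver.Path.cons p e => path p * edge K e

/-- The element `p* = eₙ* ⋯ e₁*` of `L_K(E)` given by a path `p = e₁ ⋯ eₙ`. -/
noncomputable def pathStar {a : V} : {b : V} → Quiver.Path a b → LeavittPathAlgebra K V
  | _, Quiver.Path.nil => vertex K a
  | _, Quiver.Path.cons p e => ghost K e * pathStar p

variable (V) in
/-- The natural `ℤ`-grading: `L_K(E)ₙ` is the `K`-span of the elements `p q*` for paths `p`, `q`
(with the same range, as `p q* = 0` otherwise) such that `|p| - |q| = n`. -/
noncomputable def grading (n : ℤ) : Submodule K (LeavittPathAlgebra K V) :=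
  Submodule.span K {z | ∃ (a b c : V) (p : Quiver.Path a c) (q : Quiver.Path b c),
    (p.length : ℤ) - (q.length : ℤ) = n ∧ z = path K p * pathStar K q}

end LeavittPathAlgebra

/-! ### Gradings, graded isomorphisms, graded corners, graded matrix rings -/

section Graded

variable (K : Type u) [Field K]

/-- The trivial `ℤ`-grading of the field `K`. -/
def trivialGrading (n : ℤ) : Submodule K K := if n = 0 then ⊤ else ⊥

variable {K}

/-- The grading of `M_m(R)(γ₁, …, γₘ)`: a matrix `(r_ij)` has degree `δ` if `r_ij` has degree
`-γ_i + δ + γ_j` for all `i`, `j`. -/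
def matrixGrading {R : Type v} [Ring R] [Algebra K R] (𝓡 : ℤ → Submodule K R) {m : ℕ}
    (γ : Fin m → ℤ) (δ : ℤ) : Submodule K (Matrix (Fin m) (Fin m) R) where
  carrier := {M | ∀ i j, M i j ∈ 𝓡 (-γ i + δ + γ j)}
  add_mem' hM hN i j := add_mem (hM i j) (hN i j)
  zero_mem' _ _ := zero_mem _
  smul_mem' k _ hM i j := (𝓡 _).smul_mem k (hM i j)

variable (K) in
/-- The grading of `M_m(K)(γ₁, …, γₘ)` for the trivially graded field `K`. -/
abbrev fieldMatrixGrading {m : ℕ} (γ : Fin m → ℤ) (δ : ℤ) :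
    Submodule K (Matrix (Fin m) (Fin m) K) :=
  matrixGrading (trivialGrading K) γ δ

section Corner

variable {A : Type v} [NonUnitalRing A] [Module K A] [IsScalarTower K A A] [SMulCommClass K A A]

variable (K) in
/-- The corner `eAe` of a `K`-algebra `A`. -/
def corner (e : A) : NonUnitalSubalgebra K A where
  carrier := {z | ∃ r : A, z = e * r * e}
  add_mem' := by
    rintro _ _ ⟨r, rfl⟩ ⟨s, rfl⟩
    exact ⟨r + s, by rw [mul_add, add_mul]⟩
  zero_mem' := ⟨0, by rw [mul_zero, zero_mul]⟩
  mul_mem' := by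
    rintro _ _ ⟨r, rfl⟩ ⟨s, rfl⟩
    exact ⟨r * e * e * s, by simp only [mul_assoc]⟩
  smul_mem' := by
    rintro k _ ⟨r, rfl⟩
    exact ⟨k • r, by rw [mul_smul_comm, smul_mul_assoc]⟩

/-- The grading `(eAe)ₙ = eAe ∩ Aₙ` of the corner by a homogeneous idempotent `e`. -/
def cornerGrading (𝒜 : ℤ → Submodule K A) (e : A) (n : ℤ) : Submodule K (corner K e) :=
  (𝒜 n).comap (corner K e).toSubmodule.subtype

end Corner

/-- `f` is a graded ring isomorphism: `f` maps the degree `n` component onto the degree `n`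
component for all `n`. The two sides may be algebras over different fields. -/
def IsGradedRingIso {F : Type w} [Field F] {A : Type v} {B : Type x}
    [NonUnitalRing A] [Module K A] [NonUnitalRing B] [Module F B]
    (𝒜 : ℤ → Submodule K A) (𝓑 : ℤ → Submodule F B) (f : A ≃+* B) : Prop :=
  ∀ (n : ℤ) (a : A), f a ∈ 𝓑 n ↔ a ∈ 𝒜 n

/-- `A ≅_gr B` as graded rings. -/
def GradedRingIsomorphic {F : Type w} [Field F] {A : Type v} {B : Type x}
    [NonUnitalRing A] [Module K A] [NonUnitalRing B] [Module F B]
    (𝒜 : ℤ → Submodule K A) (𝓑 : ℤ → Submodule F B) : Prop :=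
  ∃ f : A ≃+* B, IsGradedRingIso 𝒜 𝓑 f

variable (K) in
/-- A ring isomorphism of `K`-algebras is a `K`-algebra isomorphism. -/
def IsKLinear {A : Type v} {B : Type x} [NonUnitalRing A] [Module K A]
    [NonUnitalRing B] [Module K B] (f : A ≃+* B) : Prop :=
  ∀ (k : K) (a : A), f (k • a) = k • f a

end Graded

/-! ### The line graph `u ⟶ v ⟶ w` -/

/-- The vertices of the line graph. -/
inductive LineVertex : Type
  | u
  | v
  | w

/-- The edges of the line graph. -/
inductive LineEdge : LineVertex → LineVertex → Type
  | e : LineEdge LineVertex.u LineVertex.v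
  | f : LineEdge LineVertex.v LineVertex.w

instance LineVertex.instQuiver : Quiver.{0} LineVertex := ⟨LineEdge⟩

/-- The element `u + w` of the Leavitt path algebra of the line graph. -/
noncomputable def lineIdem (K : Type u) [Field K] : LeavittPathAlgebra K LineVertex :=
  LeavittPathAlgebra.vertex K LineVertex.u + LeavittPathAlgebra.vertex K LineVertex.w

/-! In the line graph every vertex `a` emits at most one edge and has a path `p_a` to the sink. The
relations `g*g = r(g)` make the elements `p_a p_b*` multiply like matrix units (`ofMatrix_mul`).
Since the Cuntz–Krieger sum at a non-sink has a single term, `p_a p_a* = a`, so these elements span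
(`ofMatrix_surjective`). Their degrees `|p_a| - |p_b|` give the shifts: distances to the sink, here
`0, 1, 2`. Cutting by `u + w` deletes the middle index and leaves `M₂(K)(0,2)`. This ring has
nonzero components exactly in degrees `-2, 0, 2`. In a Leavitt path algebra, however, `p q*` of
positive degree contains an edge, which has degree `1`; if degree `1` vanishes, so do all positive
degrees (`grading_eq_bot_of_grading_one_eq_bot`). Without gradings, `M₂(K)` comes from the graph
with one edge. -/

namespace LeavittPathAlgebra

/-! ### The defining relations inside the Leavitt path algebra. -/

section Relations

variable (K : Type u) [Field K] {V : Type v} [Quiver.{w} V]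

lemma vertex_mul_self (a : V) : vertex K a * vertex K a = vertex K a := by
  refine Subtype.ext ?_
  have h := RingQuot.mkAlgHom_rel K (LeavittRel.vertex_mul_self (K := K) a)
  rwa [map_mul] at h

lemma vertex_mul_of_ne {a b : V} (hab : a ≠ b) : vertex K a * vertex K b = 0 := by
  refine Subtype.ext ?_
  have h := RingQuot.mkAlgHom_rel K (LeavittRel.vertex_mul_of_ne (K := K) hab)
  rwa [map_mul, map_zero] at h

lemma source_mul_edge {a b : V} (e : a ⟶ b) : vertex K a * edge K e = edge K e := by
  refine Subtype.ext ?_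
  have h := RingQuot.mkAlgHom_rel K (LeavittRel.source_mul_edge (K := K) e)
  rwa [map_mul] at h

lemma edge_mul_range {a b : V} (e : a ⟶ b) : edge K e * vertex K b = edge K e := by
  refine Subtype.ext ?_
  have h := RingQuot.mkAlgHom_rel K (LeavittRel.edge_mul_range (K := K) e)
  rwa [map_mul] at h

lemma range_mul_ghost {a b : V} (e : a ⟶ b) : vertex K b * ghost K e = ghost K e := by
  refine Subtype.ext ?_
  have h := RingQuot.mkAlgHom_rel K (LeavittRel.range_mul_ghost (K := K) e)
  rwa [map_mul] at h

lemma ghost_mul_source {a b : V} (e : a ⟶ b) : ghost K e * vertex K a = ghost K e := by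
  refine Subtype.ext ?_
  have h := RingQuot.mkAlgHom_rel K (LeavittRel.ghost_mul_source (K := K) e)
  rwa [map_mul] at h

lemma ghost_mul_edge_self {a b : V} (e : a ⟶ b) : ghost K e * edge K e = vertex K b := by
  refine Subtype.ext ?_
  have h := RingQuot.mkAlgHom_rel K (LeavittRel.ck1_self (K := K) e)
  rwa [map_mul] at h

lemma edge_mul_ghost_self {a b : V} [Subsingleton (EmittedEdges a)] (e : a ⟶ b) :
    edge K e * ghost K e = vertex K a := by
  let _ : Fintype (EmittedEdges a) := Fintype.ofSubsingleton ⟨b, e⟩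
  have : Nonempty (EmittedEdges a) := ⟨⟨b, e⟩⟩
  refine Subtype.ext ?_
  have h := RingQuot.mkAlgHom_rel K (LeavittRel.ck2 (K := K) a)
  rw [Fintype.sum_subsingleton _ ⟨b, e⟩, map_mul] at h
  exact h.symm

end Relations

/-! ### Products of paths and ghost paths, and their degrees. -/

section Paths

variable (K : Type u) [Field K] {V : Type v} [Quiver.{w} V]

lemma vertex_mul_path {a b : V} (p : Quiver.Path a b) : vertex K a * path K p = path K p := by
  induction p with
  | nil => exact vertex_mul_self K a
  | cons p e ih => rw [path, ← mul_assoc, ih]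

lemma pathStar_mul_vertex {a b : V} (p : Quiver.Path a b) :
    pathStar K p * vertex K a = pathStar K p := by
  induction p with
  | nil => exact vertex_mul_self K a
  | cons p e ih => rw [pathStar, mul_assoc, ih]

lemma vertex_mul_pathStar {a b : V} (p : Quiver.Path a b) :
    vertex K b * pathStar K p = pathStar K p := by
  cases p with
  | nil => exact vertex_mul_self K a
  | cons p e => rw [pathStar, ← mul_assoc, range_mul_ghost]

lemma pathStar_mul_path_self {a b : V} (p : Quiver.Path a b) :
    pathStar K p * path K p = vertex K b := by
  induction p with
  | nil => exact vertex_mul_self K a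
  | cons p e ih =>
    rw [path, pathStar, mul_assoc, ← mul_assoc (pathStar K p), ih, source_mul_edge,
      ghost_mul_edge_self]

lemma pathStar_mul_path_of_ne {a b c d : V} (p : Quiver.Path a b) (q : Quiver.Path c d)
    (h : a ≠ c) : pathStar K p * path K q = 0 := by
  rw [← pathStar_mul_vertex, ← vertex_mul_path K q, mul_assoc, ← mul_assoc (vertex K a),
    vertex_mul_of_ne K h, zero_mul, mul_zero]

/-- The product telescopes from the inside, because `e e*` is the whole source vertex when no other
edge leaves it. -/
lemma path_mul_pathStar_self [∀ a : V, Subsingleton (EmittedEdges a)] {a b : V}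
    (p : Quiver.Path a b) : path K p * pathStar K p = vertex K a := by
  induction p with
  | nil => exact vertex_mul_self K a
  | cons p e ih =>
    rw [path, pathStar, mul_assoc, ← mul_assoc (edge K e), edge_mul_ghost_self,
      vertex_mul_pathStar, ih]

/-- Paths grow at their end, whereas paths to a sink are compared by removing their first edge. -/
lemma path_toPath_comp {a b c : V} (e : a ⟶ b) (p : Quiver.Path b c) :
    path K (e.toPath.comp p) = edge K e * path K p := by
  induction p with
  | nil => exact (source_mul_edge K e).trans (edge_mul_range K e).symm
  | cons p e' ih => rw [Quiver.Path.comp_cons, path, path, ih, mul_assoc]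

lemma pathStar_toPath_comp {a b c : V} (e : a ⟶ b) (p : Quiver.Path b c) :
    pathStar K (e.toPath.comp p) = pathStar K p * ghost K e := by
  induction p with
  | nil => exact (ghost_mul_source K e).trans (range_mul_ghost K e).symm
  | cons p e' ih => rw [Quiver.Path.comp_cons, pathStar, pathStar, ih, mul_assoc]

lemma path_mul_pathStar_mem_grading {a b c : V} (p : Quiver.Path a c) (q : Quiver.Path b c) :
    path K p * pathStar K q ∈ grading K V ((p.length : ℤ) - q.length) :=
  Submodule.subset_span ⟨a, b, c, p, q, rfl, rfl⟩

lemma vertex_mem_grading (a : V) : vertex K a ∈ grading K V 0 := by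
  have h := path_mul_pathStar_mem_grading K (Quiver.Path.nil : Quiver.Path a a) Quiver.Path.nil
  simpa only [path, pathStar, vertex_mul_self, sub_self] using h

lemma edge_mem_grading {a b : V} (e : a ⟶ b) : edge K e ∈ grading K V 1 := by
  have h := path_mul_pathStar_mem_grading K e.toPath (Quiver.Path.nil : Quiver.Path b b)
  simpa [Quiver.Hom.toPath, path, pathStar, source_mul_edge, edge_mul_range] using h

/-- If there are no nonzero elements of degree `1`, then there are none of positive degree. -/
lemma grading_eq_bot_of_grading_one_eq_bot (h : grading K V 1 = ⊥) {n : ℤ} (hn : 0 < n) :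
    grading K V n = ⊥ := by
  refine (Submodule.span_eq_bot).2 ?_
  rintro _ ⟨a, b, c, p, q, hpq, rfl⟩
  cases p with
  -- A trivial `p` would give degree `-|q| ≤ 0`.
  | nil => simp at hpq; omega
  | cons p e =>
    have he : edge K e = 0 := (Submodule.mem_bot K).1 (h ▸ edge_mem_grading K e)
    rw [path, he, mul_zero, zero_mul]

end Paths

/-! ### The universal property and induction on generators. -/

section Lift

variable {K : Type u} [Field K] {V : Type v} [Quiver.{w} V]

/-- The homomorphism given by a map on generators which respects the relations. -/
noncomputable def liftHom {B : Type x} [Ring B] [Algebra K B] (f : LeavittGen V → B)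
    (h : ∀ ⦃x y⦄, LeavittRel K V x y → FreeAlgebra.lift K f x = FreeAlgebra.lift K f y) :
    LeavittPathAlgebra K V →ₙₐ[K] B :=
  ((RingQuot.liftAlgHom K ⟨FreeAlgebra.lift K f, h⟩ :
    LeavittUnitization K V →ₐ[K] B) : LeavittUnitization K V →ₙₐ[K] B).comp
    (NonUnitalSubalgebraClass.subtype (leavittSubalgebra K V))

lemma liftHom_gen {B : Type x} [Ring B] [Algebra K B] (f : LeavittGen V → B)
    (h : ∀ ⦃x y⦄, LeavittRel K V x y → FreeAlgebra.lift K f x = FreeAlgebra.lift K f y)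
    (g : LeavittGen V) : liftHom f h (gen K g) = f g := by
  change RingQuot.liftAlgHom K ⟨FreeAlgebra.lift K f, h⟩ (RingQuot.mkAlgHom K _ _) = _
  rw [RingQuot.liftAlgHom_mkAlgHom_apply, FreeAlgebra.lift_ι_apply]

/-- Induction on elements of a Leavitt path algebra. -/
lemma gen_induction {P : LeavittPathAlgebra K V → Prop} (hgen : ∀ g, P (gen K g)) (h0 : P 0)
    (hadd : ∀ x y, P x → P y → P (x + y)) (hmul : ∀ x y, P x → P y → P (x * y))
    (hsmul : ∀ (k : K) x, P x → P (k • x)) (x : LeavittPathAlgebra K V) : P x := by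
  obtain ⟨x, hx⟩ := x
  induction hx using NonUnitalAlgebra.adjoin_induction with
  | mem x hx => obtain ⟨g, rfl⟩ := hx; exact hgen g
  | add x y hx hy ihx ihy => exact hadd _ _ ihx ihy
  | zero => exact h0
  | mul x y hx hy ihx ihy => exact hmul _ _ ihx ihy
  | smul k x hx ih => exact hsmul k _ ih

end Lift

/-! ### Graphs with at most one edge out of each vertex and paths to a common vertex. -/

section Matrix

variable (K : Type u) [Field K] {V : Type v} [Quiver.{w} V] {n : ℕ} (ι : V ≃ Fin n)

variable {s : V} (p : ∀ a : V, Quiver.Path a s)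

/-- The linear map sending the matrix unit at `(a, b)` to `p_a p_b*`. -/
noncomputable def ofMatrix : Matrix (Fin n) (Fin n) K →ₗ[K] LeavittPathAlgebra K V where
  toFun M := ∑ i, ∑ j, M i j • (path K (p (ι.symm i)) * pathStar K (p (ι.symm j)))
  map_add' M N := by simp only [Matrix.add_apply, add_smul, Finset.sum_add_distrib]
  map_smul' k M := by
    simp only [Matrix.smul_apply, smul_eq_mul, mul_smul, Finset.smul_sum, RingHom.id_apply]

lemma ofMatrix_apply (M : Matrix (Fin n) (Fin n) K) : ofMatrix K ι p M =
    ∑ i, ∑ j, M i j • (path K (p (ι.symm i)) * pathStar K (p (ι.symm j))) := rfl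

lemma ofMatrix_single (a b : V) :
    ofMatrix K ι p (Matrix.single (ι a) (ι b) 1) = path K (p a) * pathStar K (p b) := by
  rw [ofMatrix_apply, Finset.sum_eq_single (ι a), Finset.sum_eq_single (ι b)]
  · rw [Matrix.single_apply_same, one_smul, congrArg (path K <| p ·) (ι.symm_apply_apply a),
      congrArg (pathStar K <| p ·) (ι.symm_apply_apply b)]
  · intro j _ hj; simp [hj.symm]
  · simp
  · intro i _ hi; simp [hi.symm]
  · simp

/-- All chosen paths end at `s`, so `p_j* p_k` is `s` if `j = k`, and `0` otherwise because the
sources differ. -/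
lemma ofMatrix_mul (M N : Matrix (Fin n) (Fin n) K) :
    ofMatrix K ι p (M * N) = ofMatrix K ι p M * ofMatrix K ι p N := by
  have key (i j k l : Fin n) : path K (p (ι.symm i)) * pathStar K (p (ι.symm j)) *
      (path K (p (ι.symm k)) * pathStar K (p (ι.symm l))) =
      if j = k then path K (p (ι.symm i)) * pathStar K (p (ι.symm l)) else 0 := by
    rw [mul_assoc, ← mul_assoc (pathStar K _)]
    split_ifs with h
    · rw [h, pathStar_mul_path_self, vertex_mul_pathStar]
    · rw [pathStar_mul_path_of_ne K _ _ (by simpa using h), zero_mul, mul_zero]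
  simp only [ofMatrix_apply, Finset.sum_mul, Finset.mul_sum, smul_mul_smul_comm, key,
    Matrix.mul_apply, Finset.sum_smul]
  simp only [smul_ite, smul_zero, Finset.sum_ite_eq', Finset.mem_univ, if_true]
  conv_rhs => rw [Finset.sum_comm]
  rw [Finset.sum_comm]
  exact Finset.sum_congr rfl fun _ _ => Finset.sum_comm

/-- The matrix units to which the generators are mapped. -/
def genMatrix : LeavittGen V → Matrix (Fin n) (Fin n) K
  | .vertex a => Matrix.single (ι a) (ι a) 1
  | @LeavittGen.edge _ _ a b _ => Matrix.single (ι a) (ι b) 1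
  | @LeavittGen.ghost _ _ a b _ => Matrix.single (ι b) (ι a) 1

/-- Only the last two relations need the hypothesis: distinct edges have distinct sources, and the
Cuntz–Krieger sum has one term. -/
lemma genMatrix_rel [∀ a : V, Subsingleton (EmittedEdges a)] ⦃x y : FreeAlgebra K (LeavittGen V)⦄
    (h : LeavittRel K V x y) :
    FreeAlgebra.lift K (genMatrix K ι) x = FreeAlgebra.lift K (genMatrix K ι) y := by
  cases h with
  | vertex_mul_self a => simp [genMatrix]
  | vertex_mul_of_ne h => simp [genMatrix, h]
  | source_mul_edge e => simp [genMatrix]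
  | edge_mul_range e => simp [genMatrix]
  | range_mul_ghost e => simp [genMatrix]
  | ghost_mul_source e => simp [genMatrix]
  | ck1_self e => simp [genMatrix]
  | @ck1_ne e f h =>
    obtain ⟨a, b, e⟩ := e
    obtain ⟨c, d, f⟩ := f
    have hac : a ≠ c := by
      rintro rfl
      have := Subsingleton.elim (⟨b, e⟩ : EmittedEdges a) ⟨d, f⟩
      cases this
      exact h rfl
    simp [genMatrix, hac]
  | ck2 a =>
    obtain ⟨e⟩ := ‹Nonempty (EmittedEdges a)›
    rw [Fintype.sum_subsingleton _ e]
    simp [genMatrix]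

/-- The homomorphism mapping vertices, edges and ghost edges to matrix units. -/
noncomputable def toMatrix [∀ a : V, Subsingleton (EmittedEdges a)] :
    LeavittPathAlgebra K V →ₙₐ[K] Matrix (Fin n) (Fin n) K :=
  liftHom (genMatrix K ι) (genMatrix_rel K ι)

variable [∀ a : V, Subsingleton (EmittedEdges a)]

lemma toMatrix_gen (g : LeavittGen V) : toMatrix K ι (gen K g) = genMatrix K ι g :=
  liftHom_gen _ _ _

lemma toMatrix_path {a b : V} (p : Quiver.Path a b) :
    toMatrix K ι (path K p) = Matrix.single (ι a) (ι b) 1 := by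
  induction p with
  | nil => exact toMatrix_gen K ι _
  | cons p e ih => rw [path, map_mul, ih, edge, toMatrix_gen]; simp [genMatrix]

lemma toMatrix_pathStar {a b : V} (p : Quiver.Path a b) :
    toMatrix K ι (pathStar K p) = Matrix.single (ι b) (ι a) 1 := by
  induction p with
  | nil => exact toMatrix_gen K ι _
  | cons p e ih => rw [pathStar, map_mul, ih, ghost, toMatrix_gen]; simp [genMatrix]

lemma toMatrix_ofMatrix (M : Matrix (Fin n) (Fin n) K) :
    toMatrix K ι (ofMatrix K ι p M) = M := by
  conv_rhs => rw [Matrix.matrix_eq_sum_single M]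
  simp [ofMatrix_apply, map_sum, toMatrix_path, toMatrix_pathStar]

variable (hp : ∀ {a b : V} (e : a ⟶ b), p a = e.toPath.comp (p b))

-- The range is closed under the algebra operations, so generators suffice: an edge `e : a ⟶ b`
-- equals `e p_b p_b* = p_a p_b*`, and dually for ghosts.
include hp in
lemma ofMatrix_surjective : Function.Surjective (ofMatrix K ι p) := by
  intro x
  induction x using gen_induction with
  | hgen g =>
    cases g with
    | vertex a => exact ⟨_, (ofMatrix_single K ι p a a).trans (path_mul_pathStar_self K _)⟩
    | @edge a b e =>
      refine ⟨_, (ofMatrix_single K ι p a b).trans ?_⟩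
      rw [hp e, path_toPath_comp, mul_assoc, path_mul_pathStar_self]
      exact edge_mul_range K e
    | @ghost a b e =>
      refine ⟨_, (ofMatrix_single K ι p b a).trans ?_⟩
      rw [hp e, pathStar_toPath_comp, ← mul_assoc, path_mul_pathStar_self]
      exact range_mul_ghost K e
  | h0 => exact ⟨0, map_zero _⟩
  | hadd x y hx hy =>
    obtain ⟨M, rfl⟩ := hx
    obtain ⟨N, rfl⟩ := hy
    exact ⟨M + N, map_add _ _ _⟩
  | hmul x y hx hy =>
    obtain ⟨M, rfl⟩ := hx
    obtain ⟨N, rfl⟩ := hy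
    exact ⟨M * N, ofMatrix_mul K ι p M N⟩
  | hsmul k x hx =>
    obtain ⟨M, rfl⟩ := hx
    exact ⟨k • M, map_smul _ _ _⟩

include hp in
lemma ofMatrix_toMatrix (x : LeavittPathAlgebra K V) :
    ofMatrix K ι p (toMatrix K ι x) = x := by
  obtain ⟨M, rfl⟩ := ofMatrix_surjective K ι p hp x
  rw [toMatrix_ofMatrix]

/-- If every vertex emits at most one edge and all vertices lead to `s`, then the Leavitt path
algebra is a matrix algebra over the field. -/
noncomputable def matrixEquiv : LeavittPathAlgebra K V ≃+* Matrix (Fin n) (Fin n) K where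
  toFun := toMatrix K ι
  invFun := ofMatrix K ι p
  left_inv := ofMatrix_toMatrix K ι p hp
  right_inv := toMatrix_ofMatrix K ι p
  map_mul' := map_mul _
  map_add' := map_add _

lemma matrixEquiv_apply (x : LeavittPathAlgebra K V) :
    matrixEquiv K ι p hp x = toMatrix K ι x := rfl

lemma isKLinear_matrixEquiv : IsKLinear K (matrixEquiv K ι p hp) :=
  fun k x => map_smul (toMatrix K ι) k x

lemma single_mem_fieldMatrixGrading (γ : Fin n → ℤ) (i j : Fin n) :
    Matrix.single i j (1 : K) ∈ fieldMatrixGrading K γ (γ i - γ j) := by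
  intro k l
  by_cases h : i = k ∧ j = l
  · obtain ⟨rfl, rfl⟩ := h
    have h0 : -γ i + (γ i - γ j) + γ j = 0 := by ring
    rw [h0, Matrix.single_apply_same]
    exact Submodule.mem_top
  · have h0 : Matrix.single i j (1 : K) k l = 0 := by simp [h]
    rw [h0]
    exact zero_mem _

lemma isGradedRingIso_matrixEquiv (γ : Fin n → ℤ) (hγ : ∀ a, γ (ι a) = (p a).length) :
    IsGradedRingIso (grading K V) (fieldMatrixGrading K γ) (matrixEquiv K ι p hp) := by
  -- By `hp`, `γ` drops by one along each edge, so it measures every path and not only the chosen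
  -- ones.
  have hlen : ∀ {a b : V} (q : Quiver.Path a b), γ (ι a) - γ (ι b) = q.length := by
    intro a b q
    induction q with
    | nil => simp
    | cons q e ih =>
      have := congrArg Quiver.Path.length (hp e)
      rw [Quiver.Path.length_comp, Quiver.Path.length_toPath] at this
      rw [hγ] at ih ⊢
      rw [hγ] at ih ⊢
      rw [Quiver.Path.length_cons]
      push_cast
      omega
  intro m x
  constructor
  · intro h
    rw [← ofMatrix_toMatrix K ι p hp x, ofMatrix_apply]
    refine sum_mem fun i _ => sum_mem fun j _ => ?_
    have hij := h i j
    rw [matrixEquiv_apply, trivialGrading] at hij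
    split_ifs at hij with hm
    -- Here `m = γ i - γ j`, the degree of `p_i p_j*`; in the other case the entry is zero.
    · have := path_mul_pathStar_mem_grading K (p (ι.symm i)) (p (ι.symm j))
      rw [← hγ, ← hγ, ι.apply_symm_apply, ι.apply_symm_apply] at this
      refine Submodule.smul_mem _ _ ?_
      convert this using 2
      omega
    · rw [(Submodule.mem_bot K).1 hij, zero_smul]
      exact zero_mem _
  · intro h
    induction h using Submodule.span_induction with
    | mem x hx =>
      obtain ⟨a, b, c, q, r, hqr, rfl⟩ := hx
      rw [matrixEquiv_apply, map_mul, toMatrix_path, toMatrix_pathStar,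
        Matrix.single_mul_single_same, mul_one]
      convert single_mem_fieldMatrixGrading K γ (ι a) (ι b) using 2
      rw [← hqr, ← hlen q, ← hlen r]
      ring
    | zero => rw [map_zero]; exact zero_mem _
    | add x y _ _ hx hy => rw [map_add]; exact add_mem hx hy
    | smul k x _ hx => rw [isKLinear_matrixEquiv]; exact Submodule.smul_mem _ k hx

end Matrix

end LeavittPathAlgebra

/-! ### Corners of matrix rings. -/

section Corner

variable {K : Type u} [Field K] {A : Type v} [NonUnitalRing A] [Module K A]
  [IsScalarTower K A A] [SMulCommClass K A A]

lemma idem_mul_corner {e : A} (he : IsIdempotentElem e) (z : corner K e) : e * z = z := by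
  obtain ⟨_, r, rfl⟩ := z
  simp only [← mul_assoc, he.eq]

lemma corner_mul_idem {e : A} (he : IsIdempotentElem e) (z : corner K e) : z * e = (z : A) := by
  obtain ⟨_, r, rfl⟩ := z
  simp only [mul_assoc, he.eq]

/-- The corner by an idempotent which an isomorphism to a matrix ring maps to `P Q`, where
`Q P = 1`, is again a matrix ring. -/
def cornerMatrixEquiv {m n : ℕ} (φ : A ≃+* Matrix (Fin n) (Fin n) K) {e : A}
    (he : IsIdempotentElem e) (P : Matrix (Fin n) (Fin m) K) (Q : Matrix (Fin m) (Fin n) K)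
    (hQP : Q * P = 1) (hφ : φ e = P * Q) : corner K e ≃+* Matrix (Fin m) (Fin m) K where
  toFun z := Q * φ z * P
  invFun N := ⟨φ.symm (P * N * Q), φ.symm (P * N * Q), φ.injective <| by
    simp only [map_mul, hφ, φ.apply_symm_apply]
    -- Inserting `Q P = 1` shows that `P N Q` is fixed by `P Q = φ e` on both sides, hence lies in
    -- the corner.
    calc P * N * Q = P * (Q * P) * N * (Q * P) * Q := by simp [hQP]
      _ = _ := by simp only [Matrix.mul_assoc]⟩
  left_inv z := Subtype.ext <| φ.injective <| by
    rw [φ.apply_symm_apply]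
    calc P * (Q * φ z * P) * Q = P * Q * φ z * (P * Q) := by simp only [Matrix.mul_assoc]
      _ = φ z := by
        rw [← hφ, ← map_mul, ← map_mul, idem_mul_corner he, corner_mul_idem he]
  right_inv N := by
    change Q * φ (φ.symm (P * N * Q)) * P = N
    rw [φ.apply_symm_apply]
    calc Q * (P * N * Q) * P = Q * P * N * (Q * P) := by simp only [Matrix.mul_assoc]
      _ = N := by simp [hQP]
  map_mul' y z := by
    -- The inserted `e` becomes the factor `P Q` that separates the two images.
    calc Q * φ (y * z : A) * P = Q * φ (y * e * z) * P := by rw [corner_mul_idem he]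
      _ = _ := by simp only [map_mul, hφ, Matrix.mul_assoc]
  map_add' y z := by
    change Q * φ (y + z : A) * P = _
    rw [map_add, Matrix.mul_add, Matrix.add_mul]

end Corner

/-! ### The obstruction to being a graded Leavitt path algebra. -/

section Graded

variable {K : Type u} [Field K]

lemma GradedRingIsomorphic.of_isGradedRingIso {F : Type*} [Field F] {A B C : Type*}
    [NonUnitalRing A] [Module K A] [NonUnitalRing B] [Module K B] [NonUnitalRing C] [Module F C]
    {𝒜 : ℤ → Submodule K A} {𝓑 : ℤ → Submodule K B} {𝓒 : ℤ → Submodule F C}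
    {f : A ≃+* B} (hf : IsGradedRingIso 𝒜 𝓑 f) (h : GradedRingIsomorphic 𝒜 𝓒) :
    GradedRingIsomorphic 𝓑 𝓒 := by
  obtain ⟨g, hg⟩ := h
  refine ⟨f.symm.trans g, fun n b => ?_⟩
  rw [RingEquiv.trans_apply, hg, ← hf, f.apply_symm_apply]

/-- `M₂(K)(0, 2)` has nonzero elements of degree `2`, but none of degree `1`. -/
lemma not_gradedRingIsomorphic_leavitt (F : Type x) [Field F] (V : Type v) [Quiver.{w} V] :
    ¬ GradedRingIsomorphic (fieldMatrixGrading K ![0, 2])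
      (LeavittPathAlgebra.grading F V) := by
  rintro ⟨f, hf⟩
  -- The differences of the shifts `0, 2` are even, so no entry can have degree `1`.
  have h1 : LeavittPathAlgebra.grading F V 1 = ⊥ := by
    refine (Submodule.eq_bot_iff _).2 fun x hx => ?_
    rw [← f.apply_symm_apply x, hf] at hx
    rw [← f.symm.map_eq_zero_iff]
    ext i j
    have := hx i j
    fin_cases i <;> fin_cases j <;> simpa [trivialGrading] using this
  have h2 := LeavittPathAlgebra.grading_eq_bot_of_grading_one_eq_bot F h1 (n := 2) (by norm_num)
  have h3 : f (Matrix.single 1 0 1) ∈ LeavittPathAlgebra.grading F V 2 := by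
    rw [hf]
    exact LeavittPathAlgebra.single_mem_fieldMatrixGrading K ![0, 2] 1 0
  rw [h2, Submodule.mem_bot, f.map_eq_zero_iff] at h3
  simpa using congrFun (congrFun h3 1) 0

end Graded

/-! ### The line graphs with three and with two vertices -/

namespace LineVertex

/-- The index of the row and column corresponding to a vertex: the distance from the sink. -/
def equivFin : LineVertex ≃ Fin 3 where
  toFun | u => 2 | v => 1 | w => 0
  invFun := ![w, v, u]
  left_inv a := by cases a <;> rfl
  right_inv i := by fin_cases i <;> rfl

instance (a : LineVertex) : Subsingleton (EmittedEdges a) :=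
  ⟨by rintro ⟨b, ⟨⟩⟩ ⟨c, ⟨⟩⟩ <;> rfl⟩

/-- The path from a vertex to the sink. -/
def pathToSink : ∀ a : LineVertex, Quiver.Path a w
  | u => (Quiver.Path.nil.cons LineEdge.e).cons LineEdge.f
  | v => Quiver.Path.nil.cons LineEdge.f
  | w => Quiver.Path.nil

lemma pathToSink_eq {a b : LineVertex} : ∀ g : a ⟶ b,
    pathToSink a = g.toPath.comp (pathToSink b)
  | .e => rfl
  | .f => rfl

end LineVertex

/-- The vertices of the graph with a single edge. -/
inductive EdgeVertex : Type
  | source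
  | sink

/-- The edge of the graph with a single edge. -/
inductive EdgeEdge : EdgeVertex → EdgeVertex → Type
  | e : EdgeEdge EdgeVertex.source EdgeVertex.sink

namespace EdgeVertex

instance instQuiver : Quiver.{0} EdgeVertex := ⟨EdgeEdge⟩

/-- The index of the row and column corresponding to a vertex: the distance from the sink. -/
def equivFin : EdgeVertex ≃ Fin 2 where
  toFun | source => 1 | sink => 0
  invFun := ![sink, source]
  left_inv a := by cases a <;> rfl
  right_inv i := by fin_cases i <;> rfl

instance (a : EdgeVertex) : Subsingleton (EmittedEdges a) :=
  ⟨by rintro ⟨b, ⟨⟩⟩ ⟨c, ⟨⟩⟩; rfl⟩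

/-- This yields the finiteness of the edge sets. -/
instance (a b : EdgeVertex) : Subsingleton (a ⟶ b) := ⟨by rintro ⟨⟩ ⟨⟩; rfl⟩

/-- The path from a vertex to the sink. -/
def pathToSink : ∀ a : EdgeVertex, Quiver.Path a sink
  | source => Quiver.Path.nil.cons EdgeEdge.e
  | sink => Quiver.Path.nil

lemma pathToSink_eq {a b : EdgeVertex} : ∀ g : a ⟶ b,
    pathToSink a = g.toPath.comp (pathToSink b)
  | .e => rfl

end EdgeVertex

/-! ### The line graph and its corner at `u + w`. -/

section Line

variable (K : Type u) [Field K]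

open LeavittPathAlgebra

/-- The isomorphism from the Leavitt path algebra of the line graph to `M₃(K)`. -/
noncomputable def lineMatrixEquiv :
    LeavittPathAlgebra K LineVertex ≃+* Matrix (Fin 3) (Fin 3) K :=
  matrixEquiv K LineVertex.equivFin LineVertex.pathToSink LineVertex.pathToSink_eq

lemma isGradedRingIso_lineMatrixEquiv : IsGradedRingIso (grading K LineVertex)
    (fieldMatrixGrading K ![0, 1, 2]) (lineMatrixEquiv K) :=
  isGradedRingIso_matrixEquiv _ _ _ _ _ fun a => by cases a <;> rfl

lemma lineMatrixEquiv_lineIdem :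
    lineMatrixEquiv K (lineIdem K) = Matrix.single 0 0 1 + Matrix.single 2 2 1 := by
  -- Indices are distances to the sink, so `u` has index `2` and `w` index `0`; hence the swap of
  -- summands.
  rw [lineIdem, map_add, lineMatrixEquiv, matrixEquiv_apply, matrixEquiv_apply, vertex, vertex,
    toMatrix_gen, toMatrix_gen, add_comm]
  rfl

lemma isIdempotentElem_lineIdem : IsIdempotentElem (lineIdem K) := by
  rw [IsIdempotentElem, lineIdem, mul_add, add_mul, add_mul, vertex_mul_self, vertex_mul_self,
    vertex_mul_of_ne K (by simp), vertex_mul_of_ne K (by simp), add_zero, zero_add]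

lemma lineIdem_mem_grading : lineIdem K ∈ grading K LineVertex 0 :=
  add_mem (vertex_mem_grading K _) (vertex_mem_grading K _)

/-- The inclusion of the first and last coordinates of a three-dimensional space. -/
def outerInclusion : Matrix (Fin 3) (Fin 2) K := !![1, 0; 0, 0; 0, 1]

/-- The isomorphism from the corner to `M₂(K)`. -/
noncomputable def lineCornerEquiv : corner K (lineIdem K) ≃+* Matrix (Fin 2) (Fin 2) K :=
  cornerMatrixEquiv (lineMatrixEquiv K) (isIdempotentElem_lineIdem K) (outerInclusion K)
    (outerInclusion K).transpose
    (by ext i j; fin_cases i <;> fin_cases j <;>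
      simp [outerInclusion, Matrix.mul_apply, Fin.sum_univ_three])
    (by
      rw [lineMatrixEquiv_lineIdem]
      ext i j
      fin_cases i <;> fin_cases j <;> simp [outerInclusion, Matrix.mul_apply])

lemma lineCornerEquiv_apply (z : corner K (lineIdem K)) : lineCornerEquiv K z =
    (outerInclusion K).transpose * lineMatrixEquiv K z * outerInclusion K := rfl

lemma isKLinear_lineCornerEquiv : IsKLinear K (lineCornerEquiv K) := by
  intro k z
  rw [lineCornerEquiv_apply, lineCornerEquiv_apply, ← Matrix.smul_mul, ← Matrix.mul_smul]
  congr 2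
  exact isKLinear_matrixEquiv K LineVertex.equivFin LineVertex.pathToSink
    LineVertex.pathToSink_eq k z

/-- Degree is tested entrywise. On the corner the middle row and column vanish, and the four
remaining conditions are those for the shifts `0, 2`. -/
lemma isGradedRingIso_lineCornerEquiv :
    IsGradedRingIso (cornerGrading (grading K LineVertex) (lineIdem K))
      (fieldMatrixGrading K ![0, 2]) (lineCornerEquiv K) := by
  intro n z
  change _ ↔ (z : LeavittPathAlgebra K LineVertex) ∈ grading K LineVertex n
  rw [← isGradedRingIso_lineMatrixEquiv K n z, lineCornerEquiv_apply]
  have hz : lineMatrixEquiv K z = (Matrix.single 0 0 1 + Matrix.single 2 2 1) *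
      lineMatrixEquiv K z * (Matrix.single 0 0 1 + Matrix.single 2 2 1) := by
    rw [← lineMatrixEquiv_lineIdem, ← map_mul, ← map_mul,
      idem_mul_corner (isIdempotentElem_lineIdem K), corner_mul_idem (isIdempotentElem_lineIdem K)]
  generalize lineMatrixEquiv K z = M at hz
  have hrow (j : Fin 3) : M 1 j = 0 := by
    rw [hz, Matrix.mul_assoc, Matrix.mul_apply]
    simp
  have hcol (i : Fin 3) : M i 1 = 0 := by
    rw [hz, Matrix.mul_apply]
    simp
  change (∀ i j, _) ↔ (∀ i j, _)
  simp [Fin.forall_fin_succ, outerInclusion, Matrix.mul_apply, Fin.sum_univ_three, hrow, hcol]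

end Line

theorem mainTheorem4 (K : Type u) [Field K] :
    -- L_K(E) is graded isomorphic to M_3(K)(0,1,2), with u + w corresponding to e_11 + e_33
    (∃ φ : LeavittPathAlgebra K LineVertex ≃+* Matrix (Fin 3) (Fin 3) K,
      IsKLinear K φ ∧
      IsGradedRingIso (LeavittPathAlgebra.grading K LineVertex)
        (fieldMatrixGrading K ![0, 1, 2]) φ ∧
      φ (lineIdem K) = Matrix.single 0 0 1 + Matrix.single 2 2 1) ∧
    -- u + w is a homogeneous idempotent (of degree 0)
    IsIdempotentElem (lineIdem K) ∧
    lineIdem K ∈ LeavittPathAlgebra.grading K LineVertex 0 ∧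
    -- the graded corner is graded isomorphic to M_2(K)(0,2), as a K-algebra
    (∃ ψ : corner K (lineIdem K) ≃+* Matrix (Fin 2) (Fin 2) K,
      IsKLinear K ψ ∧
      IsGradedRingIso (cornerGrading (LeavittPathAlgebra.grading K LineVertex) (lineIdem K))
        (fieldMatrixGrading K ![0, 2]) ψ) ∧
    -- neither of the two is graded isomorphic to a Leavitt path algebra, not even as a ring
    (∀ (F : Type x) [Field F] (V : Type v) [Quiver.{w} V],
      ¬ GradedRingIsomorphic
          (cornerGrading (LeavittPathAlgebra.grading K LineVertex) (lineIdem K))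
          (LeavittPathAlgebra.grading F V) ∧
      ¬ GradedRingIsomorphic (fieldMatrixGrading K ![0, 2]) (LeavittPathAlgebra.grading F V)) ∧
    -- without the gradings, the corner is isomorphic to the Leavitt path algebra of a finite graph
    (∃ (V : Type) (_ : Quiver.{0} V), Finite V ∧ (∀ a b : V, Finite (a ⟶ b)) ∧
      ∃ θ : corner K (lineIdem K) ≃+* LeavittPathAlgebra K V, IsKLinear K θ) := by
  refine ⟨⟨lineMatrixEquiv K, LeavittPathAlgebra.isKLinear_matrixEquiv _ _ _ _,
    isGradedRingIso_lineMatrixEquiv K, lineMatrixEquiv_lineIdem K⟩, isIdempotentElem_lineIdem K,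
    lineIdem_mem_grading K, ⟨lineCornerEquiv K, isKLinear_lineCornerEquiv K,
    isGradedRingIso_lineCornerEquiv K⟩, fun F _ V _ => ⟨fun h => ?_, ?_⟩, ?_⟩
  · exact not_gradedRingIsomorphic_leavitt F V (h.of_isGradedRingIso
      (isGradedRingIso_lineCornerEquiv K))
  · exact not_gradedRingIsomorphic_leavitt F V
  -- The one-edge graph also gives `M₂(K)`, but with natural shifts `0, 1`, so this isomorphism is
  -- only ungraded.
  · let χ := LeavittPathAlgebra.matrixEquiv K EdgeVertex.equivFin EdgeVertex.pathToSink
      EdgeVertex.pathToSink_eq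
    have hχ : IsKLinear K χ := LeavittPathAlgebra.isKLinear_matrixEquiv _ _ _ _
    refine ⟨EdgeVertex, inferInstance, Finite.of_equiv _ EdgeVertex.equivFin.symm,
      fun a b => inferInstance, (lineCornerEquiv K).trans χ.symm, fun k z => χ.injective ?_⟩
    rw [hχ, RingEquiv.trans_apply, RingEquiv.trans_apply, χ.apply_symm_apply, χ.apply_symm_apply,
      isKLinear_lineCornerEquiv]
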